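/- For a monoid $S$ generated by a set $A$, the Cayley graph $\Gamma(S,A)$ has vertex set $S$ and an edge from $s$ to $sa$ for all $s\in S$, $a\in A$; it is made into a geodesic metric space with the (undirected) path metric in which every edge has length $1$. A geodesic space is hyperbolic if there is $\delta$ such that, for all points $x,y,z$ and all geodesics $\alpha,\beta,\gamma$ from $x$ to $y$, from $y$ to $z$ and from $z$ to $x$ respectively, every point of $\alpha$ is at distance less than $\delta$ from $\beta\cup\gamma$. A monoid $S$ is hyperbolic if $\Gamma(S,A)$ is hyperbolic for some finite generating set $A$ of $S$. A monoid $S$ is of finite geometric type if it has a finite generating set $A$ for which there is a constant $n$ such that, for all $q\in S$ and $a\in A$, the equation $xa=q$ has at most $n$ solutions $x\in S$. Theorem. Let $S$ be a monoid of finite geometric type, and let $T$ be a subsemigroup of $S$ such that $S\setminus T$ is finite and $T$ is itself a monoid (its identity need not be that of $S$). Then: (1) if $T$ is hyperbolic, then $S$ is hyperbolic; (2) if $S$ is hyperbolic, then $T$ is hyperbolic. -/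

import Mathlib

universe u

section MetricGeometry

variable {X : Type u} [MetricSpace X]

/-- `γ` restricted to `[0, d(x,y)]` is a geodesic (isometrically parametrised) from `x` to `y`. -/
def IsGeodesic (γ : ℝ → X) (x y : X) : Prop :=
  γ 0 = x ∧ γ (dist x y) = y ∧
    ∀ s ∈ Set.Icc 0 (dist x y), ∀ t ∈ Set.Icc 0 (dist x y), dist (γ s) (γ t) = |s - t|

/-- The set of points lying on a geodesic from `x` to `y`. -/
def geodesicTrace (γ : ℝ → X) (x y : X) : Set X :=
  γ '' Set.Icc 0 (dist x y)

/-- Any two points are joined by a geodesic. -/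
def IsGeodesicSpace (X : Type u) [MetricSpace X] : Prop :=
  ∀ x y : X, ∃ γ : ℝ → X, IsGeodesic γ x y

/-- In every geodesic triangle, each point of the side from `x` to `y` is at distance less than `δ`
from the union of the two other sides. -/
def HasThinTriangles (X : Type u) [MetricSpace X] (δ : ℝ) : Prop :=
  ∀ (x y z : X) (α β γ : ℝ → X),
    IsGeodesic α x y → IsGeodesic β y z → IsGeodesic γ z x →
      ∀ u ∈ geodesicTrace α x y,
        ∃ w ∈ geodesicTrace β y z ∪ geodesicTrace γ z x, dist u w < δ

/-- A geodesic space which is `δ`-hyperbolic for some `δ`. -/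
def IsHyperbolicSpace (X : Type u) [MetricSpace X] : Prop :=
  IsGeodesicSpace X ∧ ∃ δ : ℝ, HasThinTriangles X δ

theorem IsGeodesic.refl (x : X) : IsGeodesic (fun _ => x) x x := by
  refine ⟨rfl, rfl, ?_⟩
  intro s hs t ht
  simp only [dist_self, Set.Icc_self, Set.mem_singleton_iff] at hs ht
  simp [hs, ht]

theorem IsGeodesic.symm {γ : ℝ → X} {x y : X} (h : IsGeodesic γ x y) :
    IsGeodesic (fun t => γ (dist x y - t)) y x := by
  obtain ⟨h0, h1, h2⟩ := h
  refine ⟨by simpa using h1, by simpa [dist_comm y x] using h0, ?_⟩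
  intro s hs t ht
  rw [dist_comm y x] at hs ht
  rw [h2 _ ⟨by linarith [hs.2], by linarith [hs.1]⟩ _ ⟨by linarith [ht.2], by linarith [ht.1]⟩,
    show dist x y - s - (dist x y - t) = t - s by ring, abs_sub_comm]

theorem IsGeodesic.concat {γ η : ℝ → X} {x y z : X} (h : IsGeodesic γ x y) (k : IsGeodesic η y z)
    (hd : dist x y + dist y z ≤ dist x z) :
    IsGeodesic (fun t => if t ≤ dist x y then γ t else η (t - dist x y)) x z := by
  obtain ⟨h0, h1, h2⟩ := h
  obtain ⟨k0, k1, k2⟩ := k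
  have hxy : 0 ≤ dist x y := dist_nonneg
  have hyz : 0 ≤ dist y z := dist_nonneg
  have hd' : dist x z = dist x y + dist y z := le_antisymm (dist_triangle _ _ _) hd
  have key : ∀ s t : ℝ, 0 ≤ s → s ≤ dist x y → dist x y ≤ t → t ≤ dist x z →
      dist (γ s) (η (t - dist x y)) = t - s := by
    intro s t hs hs' ht ht'
    have e1 := h2 s ⟨hs, hs'⟩ _ ⟨hxy, le_rfl⟩
    have e2 := h2 0 ⟨le_rfl, hxy⟩ s ⟨hs, hs'⟩
    have e3 := k2 0 ⟨le_rfl, hyz⟩ (t - dist x y) ⟨by linarith, by linarith⟩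
    have e4 := k2 (t - dist x y) ⟨by linarith, by linarith⟩ _ ⟨hyz, le_rfl⟩
    rw [h1, abs_sub_comm, abs_of_nonneg (by linarith)] at e1
    rw [h0, abs_sub_comm, abs_of_nonneg (by linarith)] at e2
    rw [k0, abs_sub_comm, abs_of_nonneg (by linarith)] at e3
    rw [k1, abs_sub_comm, abs_of_nonneg (by linarith)] at e4
    have i1 := dist_triangle (γ s) y (η (t - dist x y))
    have i2 := dist_triangle x (γ s) z
    have i3 := dist_triangle (γ s) (η (t - dist x y)) z
    linarith
  refine ⟨by simp [h0], ?_, ?_⟩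
  · by_cases hz : dist x z ≤ dist x y
    · have : y = z := dist_le_zero.1 (by linarith)
      subst this
      simpa using h1
    · simp only [hz, if_false]
      rw [hd', add_sub_cancel_left, k1]
  · intro s hs t ht
    by_cases h3 : s ≤ dist x y <;> by_cases h4 : t ≤ dist x y <;> simp only [h3, h4, if_true, if_false]
    · exact h2 s ⟨hs.1, h3⟩ t ⟨ht.1, h4⟩
    · push Not at h4
      rw [key s t hs.1 h3 h4.le ht.2, abs_sub_comm, abs_of_nonneg (by linarith)]
    · push Not at h3
      rw [dist_comm, key t s ht.1 h4 h3.le hs.2, abs_of_nonneg (by linarith)]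
    · push Not at h3 h4
      rw [k2 _ ⟨by linarith, by linarith [hs.2]⟩ _ ⟨by linarith, by linarith [ht.2]⟩,
        sub_sub_sub_cancel_right]

end MetricGeometry

section Cayley

variable {S : Type u} [Monoid S]

/-- The underlying undirected simple graph of the (right) Cayley graph with edges `s → s * a`,
`a ∈ A`. Loops and repeated edges do not affect distances between vertices. -/
def cayleyGraph (A : Set S) : SimpleGraph S :=
  SimpleGraph.fromRel fun u v => ∃ a ∈ A, u * a = v

theorem cayleyGraph_reachable_mul (A : Set S) (s : S) {a : S} (ha : a ∈ A) :
    (cayleyGraph A).Reachable s (s * a) := by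
  by_cases h : s = s * a
  · rw [← h]
  · exact SimpleGraph.Adj.reachable ⟨h, Or.inl ⟨a, ha, rfl⟩⟩

theorem cayleyGraph_connected {A : Set S} (hA : Submonoid.closure A = ⊤) :
    (cayleyGraph A).Connected := by
  have h1 : ∀ s : S, (cayleyGraph A).Reachable 1 s := by
    intro s
    have hs : s ∈ Submonoid.closure A := by rw [hA]; trivial
    induction hs using Submonoid.closure_induction_right with
    | one => exact SimpleGraph.Reachable.refl _
    | mul_right x _ y hy ih => exact ih.trans (cayleyGraph_reachable_mul A x hy)
  have : Nonempty S := ⟨1⟩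
  exact SimpleGraph.Connected.mk fun u v => (h1 u).symm.trans (h1 v)

/-- Length of a shortest undirected path between two vertices of the Cayley graph. -/
noncomputable def vertexDist (A : Set S) (u v : S) : ℝ :=
  ((cayleyGraph A).dist u v : ℝ)

/-- Points of the geometric realisation of the Cayley graph `Γ(S, A)`: the vertices, and for each
edge `s → s * a` labelled `a ∈ A` the interior points of a unit interval; `edge s a t` is the point
at position `t` along that edge, counted from `s`. -/
inductive CayleyPoint {S : Type u} (A : Set S) : Type u
  | vertex (s : S) : CayleyPoint A
  | edge (s : S) (a : A) (t : Set.Ioo (0 : ℝ) 1) : CayleyPoint A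

namespace CayleyPoint

variable {A : Set S}

/-- Initial vertex of the edge carrying a point. -/
def src : CayleyPoint A → S
  | vertex s => s
  | edge s _ _ => s

/-- Terminal vertex of the edge carrying a point. -/
def tgt : CayleyPoint A → S
  | vertex s => s
  | edge s a _ => s * a

/-- Length of the part of the edge from its initial vertex to the point. -/
def pos : CayleyPoint A → ℝ
  | vertex _ => 0
  | edge _ _ t => t

/-- Length of the part of the edge from the point to its terminal vertex. -/
def rem : CayleyPoint A → ℝ
  | vertex _ => 0
  | edge _ _ t => 1 - t

/-- Both points are interior points of one and the same edge. -/
def SameEdge : CayleyPoint A → CayleyPoint A → Prop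
  | edge s a _, edge s' a' _ => s = s' ∧ a = a'
  | _, _ => False

/-- Length of a shortest path from the point `p` to the vertex `v`. -/
noncomputable def toVertex (p : CayleyPoint A) (v : S) : ℝ :=
  min (pos p + vertexDist A (src p) v) (rem p + vertexDist A (tgt p) v)

/-- Length of a shortest path from `p` to `q` among those passing through an end of the edge
carrying `p` and an end of the edge carrying `q`. -/
noncomputable def through (p q : CayleyPoint A) : ℝ :=
  min (toVertex p (src q) + pos q) (toVertex p (tgt q) + rem q)

open Classical in
/-- The path metric on the Cayley graph in which every edge has length `1`. -/
noncomputable def pathDist (p q : CayleyPoint A) : ℝ :=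
  if SameEdge p q then min |pos p - pos q| (through p q) else through p q

theorem vertexDist_self (u : S) : vertexDist A u u = 0 := by simp [vertexDist]

theorem vertexDist_nonneg (u v : S) : 0 ≤ vertexDist A u v := by simp [vertexDist]

theorem vertexDist_comm (u v : S) : vertexDist A u v = vertexDist A v u := by
  simp [vertexDist, SimpleGraph.dist_comm]

theorem vertexDist_triangle (hA : Submonoid.closure A = ⊤) (u v w : S) :
    vertexDist A u w ≤ vertexDist A u v + vertexDist A v w := by
  unfold vertexDist
  exact_mod_cast (cayleyGraph_connected hA).dist_triangle

theorem pos_nonneg (p : CayleyPoint A) : 0 ≤ pos p := by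
  cases p with
  | vertex s => exact le_rfl
  | edge s a t => exact t.2.1.le

theorem rem_nonneg (p : CayleyPoint A) : 0 ≤ rem p := by
  cases p with
  | vertex s => exact le_rfl
  | edge s a t => exact sub_nonneg.2 t.2.2.le

theorem vertexDist_src_tgt (p : CayleyPoint A) :
    vertexDist A (src p) (tgt p) ≤ pos p + rem p := by
  cases p with
  | vertex s => simp [src, tgt, pos, rem, vertexDist_self]
  | edge s a t =>
    simp only [src, tgt, pos, rem, add_sub_cancel]
    by_cases h : s = s * a
    · rw [← h, vertexDist_self]; exact zero_le_one
    · have hadj : (cayleyGraph A).Adj s (s * a) := ⟨h, Or.inl ⟨a, a.2, rfl⟩⟩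
      simp [vertexDist, SimpleGraph.dist_eq_one_iff_adj.2 hadj]

theorem SameEdge.symm {p q : CayleyPoint A} (h : SameEdge p q) : SameEdge q p := by
  cases p <;> cases q <;> simp_all [SameEdge]

theorem SameEdge.trans {p q r : CayleyPoint A} (h : SameEdge p q) (k : SameEdge q r) :
    SameEdge p r := by
  cases p <;> cases q <;> cases r <;> simp_all [SameEdge]

theorem SameEdge.src_eq {p q : CayleyPoint A} (h : SameEdge p q) : src p = src q := by
  cases p <;> cases q <;> simp_all [SameEdge, src]

theorem SameEdge.tgt_eq {p q : CayleyPoint A} (h : SameEdge p q) : tgt p = tgt q := by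
  cases p <;> cases q <;> simp_all [SameEdge, tgt]

theorem SameEdge.rem_eq {p q : CayleyPoint A} (h : SameEdge p q) :
    rem p = 1 - pos p ∧ rem q = 1 - pos q := by
  cases p <;> cases q <;> simp_all [SameEdge, pos, rem]

theorem toVertex_triangle (hA : Submonoid.closure A = ⊤) (p : CayleyPoint A) (v w : S) :
    toVertex p w ≤ toVertex p v + vertexDist A v w := by
  have h1 := vertexDist_triangle hA (src p) v w
  have h2 := vertexDist_triangle hA (tgt p) v w
  unfold toVertex
  rcases min_cases (pos p + vertexDist A (src p) v) (rem p + vertexDist A (tgt p) v) with h | h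
  · rw [h.1]; exact (min_le_left _ _).trans (by linarith)
  · rw [h.1]; exact (min_le_right _ _).trans (by linarith)

theorem toVertex_src (p : CayleyPoint A) : toVertex p (src p) ≤ pos p :=
  (min_le_left _ _).trans (by rw [vertexDist_self]; linarith)

theorem toVertex_tgt (p : CayleyPoint A) : toVertex p (tgt p) ≤ rem p :=
  (min_le_right _ _).trans (by rw [vertexDist_self]; linarith)

theorem toVertex_nonneg (p : CayleyPoint A) (v : S) : 0 ≤ toVertex p v :=
  le_min (add_nonneg (pos_nonneg p) (vertexDist_nonneg _ _))
    (add_nonneg (rem_nonneg p) (vertexDist_nonneg _ _))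

theorem through_le (hA : Submonoid.closure A = ⊤) (p q : CayleyPoint A) (v : S) :
    through p q ≤ toVertex p v + toVertex q v := by
  have h1 := toVertex_triangle hA p v (src q)
  have h2 := toVertex_triangle hA p v (tgt q)
  rw [vertexDist_comm] at h1 h2
  change _ ≤ toVertex p v + min _ _
  rcases min_cases (pos q + vertexDist A (src q) v) (rem q + vertexDist A (tgt q) v) with h | h
  · rw [h.1]; exact (min_le_left _ _).trans (by linarith)
  · rw [h.1]; exact (min_le_right _ _).trans (by linarith)

/-- A shortest path through vertices meets an end of each of the two edges. -/
theorem through_eq (p q : CayleyPoint A) :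
    ∃ v w : S, ((v = src p ∧ toVertex p v ≤ pos p) ∨ (v = tgt p ∧ toVertex p v ≤ rem p)) ∧
      ((w = src q ∧ toVertex q w ≤ pos q) ∨ (w = tgt q ∧ toVertex q w ≤ rem q)) ∧
      toVertex p v + vertexDist A v w + toVertex q w ≤ through p q := by
  have a1 := toVertex_src p
  have a2 := toVertex_tgt p
  have b1 := toVertex_src q
  have b2 := toVertex_tgt q
  have main : ∀ (w : S) (c : ℝ), toVertex q w ≤ c →
      ∃ v : S, ((v = src p ∧ toVertex p v ≤ pos p) ∨ (v = tgt p ∧ toVertex p v ≤ rem p)) ∧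
        toVertex p v + vertexDist A v w + toVertex q w ≤ toVertex p w + c := by
    intro w c hc
    rcases min_cases (pos p + vertexDist A (src p) w) (rem p + vertexDist A (tgt p) w) with h | h
    · refine ⟨src p, Or.inl ⟨rfl, a1⟩, ?_⟩
      have : toVertex p w = pos p + vertexDist A (src p) w := h.1
      linarith
    · refine ⟨tgt p, Or.inr ⟨rfl, a2⟩, ?_⟩
      have : toVertex p w = rem p + vertexDist A (tgt p) w := h.1
      linarith
  rcases min_cases (toVertex p (src q) + pos q) (toVertex p (tgt q) + rem q) with h | h
  · obtain ⟨v, hv, hv'⟩ := main _ _ b1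
    exact ⟨v, src q, hv, Or.inl ⟨rfl, b1⟩, hv'.trans h.1.ge⟩
  · obtain ⟨v, hv, hv'⟩ := main _ _ b2
    exact ⟨v, tgt q, hv, Or.inr ⟨rfl, b2⟩, hv'.trans h.1.ge⟩

theorem through_comm (hA : Submonoid.closure A = ⊤) (p q : CayleyPoint A) :
    through p q = through q p := by
  have main : ∀ p q : CayleyPoint A, through p q ≤ through q p := by
    intro p q
    obtain ⟨v, w, -, -, h⟩ := through_eq q p
    have h1 := through_le hA p q w
    have h2 := toVertex_triangle hA q v w
    linarith
  exact le_antisymm (main p q) (main q p)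

theorem through_nonneg (p q : CayleyPoint A) : 0 ≤ through p q :=
  le_min (add_nonneg (toVertex_nonneg _ _) (pos_nonneg q))
    (add_nonneg (toVertex_nonneg _ _) (rem_nonneg q))

theorem toVertex_add_ge (p : CayleyPoint A) (v w : S) (hA : Submonoid.closure A = ⊤) :
    vertexDist A v w ≤ toVertex p v + toVertex p w := by
  have h0 := vertexDist_src_tgt p
  have t1 := vertexDist_triangle hA v (src p) w
  have t2 := vertexDist_triangle hA v (tgt p) w
  have t3 := vertexDist_triangle hA (src p) (tgt p) w
  have t4 := vertexDist_triangle hA v (tgt p) (src p)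
  have c1 := vertexDist_comm (A := A) v (src p)
  have c2 := vertexDist_comm (A := A) v (tgt p)
  have c3 := vertexDist_comm (A := A) (tgt p) (src p)
  have n1 := pos_nonneg p
  have n2 := rem_nonneg p
  unfold toVertex
  rcases min_cases (pos p + vertexDist A (src p) v) (rem p + vertexDist A (tgt p) v) with h | h <;>
  rcases min_cases (pos p + vertexDist A (src p) w) (rem p + vertexDist A (tgt p) w) with k | k <;>
  rw [h.1, k.1] <;> linarith

theorem SameEdge.toVertex_le {p q : CayleyPoint A} (h : SameEdge p q) (v : S) :
    toVertex p v ≤ |pos p - pos q| + toVertex q v := by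
  have h1 := h.rem_eq
  have h2 := le_abs_self (pos p - pos q)
  have h3 := neg_abs_le (pos p - pos q)
  unfold toVertex
  rw [h.src_eq, h.tgt_eq]
  rcases min_cases (pos q + vertexDist A (src q) v) (rem q + vertexDist A (tgt q) v) with k | k
  · rw [k.1]; exact (min_le_left _ _).trans (by linarith)
  · rw [k.1]; exact (min_le_right _ _).trans (by linarith [h1.1, h1.2])

theorem pathDist_le_through (p q : CayleyPoint A) : pathDist p q ≤ through p q := by
  unfold pathDist
  split_ifs
  · exact min_le_right _ _
  · exact le_rfl

theorem SameEdge.pathDist_le {p q : CayleyPoint A} (h : SameEdge p q) :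
    pathDist p q ≤ |pos p - pos q| := by
  unfold pathDist
  rw [if_pos h]
  exact min_le_left _ _

theorem pathDist_cases (p q : CayleyPoint A) :
    pathDist p q = through p q ∨ (SameEdge p q ∧ pathDist p q = |pos p - pos q|) := by
  unfold pathDist
  split_ifs with h
  · rcases min_choice |pos p - pos q| (through p q) with k | k
    · exact Or.inr ⟨h, k⟩
    · exact Or.inl k
  · exact Or.inl rfl

theorem pathDist_self (p : CayleyPoint A) : pathDist p p = 0 := by
  apply le_antisymm
  · cases p with
    | vertex s =>
      refine (pathDist_le_through _ _).trans ((min_le_left _ _).trans ?_)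
      have := toVertex_src (vertex s : CayleyPoint A)
      simpa [pos] using this
    | edge s a t =>
      have h : SameEdge (edge s a t) (edge s a t) := ⟨rfl, rfl⟩
      simpa using h.pathDist_le
  · rcases pathDist_cases p p with h | h
    · rw [h]; exact through_nonneg _ _
    · rw [h.2]; exact abs_nonneg _

theorem pathDist_comm (hA : Submonoid.closure A = ⊤) (p q : CayleyPoint A) :
    pathDist p q = pathDist q p := by
  unfold pathDist
  rw [through_comm hA p q, abs_sub_comm]
  by_cases h : SameEdge p q
  · rw [if_pos h, if_pos h.symm]
  · rw [if_neg h, if_neg fun k => h k.symm]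

theorem pathDist_triangle (hA : Submonoid.closure A = ⊤) (p q r : CayleyPoint A) :
    pathDist p r ≤ pathDist p q + pathDist q r := by
  rcases pathDist_cases p q with h | ⟨h, h'⟩ <;> rcases pathDist_cases q r with k | ⟨k, k'⟩
  · obtain ⟨v, w, -, -, e1⟩ := through_eq p q
    obtain ⟨v', w', -, -, e2⟩ := through_eq q r
    have i1 := toVertex_add_ge q w v' hA
    have i2 := toVertex_triangle hA p v w
    have i3 := toVertex_triangle hA p w v'
    have i4 := toVertex_triangle hA p v' w'
    have i5 := through_le hA p r w'
    have i6 := pathDist_le_through p r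
    linarith
  · obtain ⟨v, w, -, -, e1⟩ := through_eq p q
    have i1 := k.symm.toVertex_le w
    have i2 := toVertex_triangle hA p v w
    have i5 := through_le hA p r w
    have i6 := pathDist_le_through p r
    rw [abs_sub_comm] at i1
    linarith
  · obtain ⟨v, w, -, -, e1⟩ := through_eq q r
    have i1 := h.toVertex_le v
    have i2 := toVertex_triangle hA p v w
    have i5 := through_le hA p r w
    have i6 := pathDist_le_through p r
    linarith
  · have i1 := (h.trans k).pathDist_le
    have i2 := abs_sub_le (pos p) (pos q) (pos r)
    linarith

theorem toVertex_edge_pos (s : S) (a : A) (t : Set.Ioo (0 : ℝ) 1) (v : S) :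
    0 < toVertex (edge s a t) v :=
  lt_min (add_pos_of_pos_of_nonneg t.2.1 (vertexDist_nonneg _ _))
    (add_pos_of_pos_of_nonneg (sub_pos.2 t.2.2) (vertexDist_nonneg _ _))

theorem eq_of_pathDist_eq_zero (hA : Submonoid.closure A = ⊤) {p q : CayleyPoint A}
    (h : pathDist p q = 0) : p = q := by
  rcases pathDist_cases p q with k | ⟨k, k'⟩
  · obtain ⟨v, w, -, -, e⟩ := through_eq p q
    have n1 := toVertex_nonneg p v
    have n2 := toVertex_nonneg q w
    have n3 := vertexDist_nonneg (A := A) v w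
    cases p with
    | edge s a t => linarith [toVertex_edge_pos s a t v]
    | vertex s =>
      cases q with
      | edge s a t => linarith [toVertex_edge_pos s a t w]
      | vertex s' =>
        have h0 : through (vertex s : CayleyPoint A) (vertex s') = 0 := by rw [← k, h]
        simp only [through, toVertex, src, tgt, pos, rem, zero_add, add_zero, min_self] at h0
        have h1 : (cayleyGraph A).dist s s' = 0 := Nat.cast_eq_zero.1 h0
        rw [((cayleyGraph_connected hA).dist_eq_zero_iff).1 h1]
  · rw [h] at k'
    have h1 : pos p = pos q := sub_eq_zero.1 (abs_eq_zero.1 k'.symm)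
    cases p with
    | vertex s => exact k.elim
    | edge s a t =>
      cases q with
      | vertex s' => exact k.elim
      | edge s' a' t' =>
        obtain ⟨rfl, rfl⟩ := k
        rw [Subtype.ext (show (t : ℝ) = t' from h1)]

end CayleyPoint

/-- The geometric realisation of the Cayley graph of `S` with respect to a generating set `A`. -/
def CayleySpace (A : Set S) (_hA : Submonoid.closure A = ⊤) : Type u :=
  CayleyPoint A

open CayleyPoint in
noncomputable instance CayleySpace.instMetricSpace (A : Set S) (hA : Submonoid.closure A = ⊤) :
    MetricSpace (CayleySpace A hA) where
  dist := fun p q : CayleyPoint A => pathDist p q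
  dist_self := pathDist_self
  dist_comm := pathDist_comm hA
  dist_triangle := pathDist_triangle hA
  eq_of_dist_eq_zero := eq_of_pathDist_eq_zero hA

namespace CayleySpace

open CayleyPoint

variable {A : Set S} {hA : Submonoid.closure A = ⊤}

variable (A hA) in
/-- A vertex, as a point of the geometric realisation. -/
def ofVertex (s : S) : CayleySpace A hA := (vertex s : CayleyPoint A)

variable (A hA) in
open Classical in
/-- The closed edge from `s` to `s * a`, parametrised by `[0, 1]`. -/
noncomputable def edgeMap (s : S) (a : A) (t : ℝ) : CayleySpace A hA :=
  if h : t ∈ Set.Ioo (0 : ℝ) 1 then (edge s a ⟨t, h⟩ : CayleyPoint A)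
  else if t ≤ 0 then ofVertex A hA s else ofVertex A hA (s * a)

theorem edgeMap_zero (s : S) (a : A) : edgeMap A hA s a 0 = ofVertex A hA s := by
  simp [edgeMap]

theorem edgeMap_one (s : S) (a : A) : edgeMap A hA s a 1 = ofVertex A hA (s * a) := by
  simp [edgeMap]

theorem edgeMap_of_mem (s : S) (a : A) (t : Set.Ioo (0 : ℝ) 1) :
    edgeMap A hA s a t = (edge s a t : CayleyPoint A) :=
  dif_pos t.2

theorem dist_ofVertex (u v : S) :
    dist (ofVertex A hA u) (ofVertex A hA v) = vertexDist A u v := by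
  change pathDist (vertex u : CayleyPoint A) (vertex v) = _
  have hn : ¬ SameEdge (vertex u : CayleyPoint A) (vertex v) := fun h => h
  unfold pathDist
  rw [if_neg hn]
  simp [through, toVertex, src, tgt, pos, rem]

theorem dist_le_toVertex (p : CayleyPoint A) (v : S) :
    dist (α := CayleySpace A hA) p (ofVertex A hA v) ≤ toVertex p v := by
  change pathDist p (vertex v) ≤ _
  refine (pathDist_le_through _ _).trans ((min_le_left _ _).trans ?_)
  simp [src, pos]

theorem dist_edgeMap_le (s : S) (a : A) {t t' : ℝ} (ht : t ∈ Set.Icc (0 : ℝ) 1)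
    (ht' : t' ∈ Set.Icc (0 : ℝ) 1) (h : t ≤ t') :
    dist (edgeMap A hA s a t) (edgeMap A hA s a t') ≤ t' - t := by
  rcases h.eq_or_lt with rfl | h
  · simp
  rcases ht.1.eq_or_lt with rfl | h0 <;> rcases ht'.2.eq_or_lt with rfl | h1
  · rw [edgeMap_zero, edgeMap_one, dist_ofVertex, sub_zero]
    have := vertexDist_src_tgt (edge s a ⟨1 / 2, by norm_num⟩ : CayleyPoint A)
    simp only [src, tgt, pos, rem] at this
    linarith
  · rw [dist_comm, edgeMap_zero, edgeMap_of_mem s a ⟨t', h, h1⟩]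
    refine (dist_le_toVertex _ _).trans ((toVertex_src (edge s a ⟨t', h, h1⟩)).trans ?_)
    simp [pos]
  · rw [edgeMap_one, edgeMap_of_mem s a ⟨t, h0, h⟩]
    exact (dist_le_toVertex _ _).trans (toVertex_tgt (edge s a ⟨t, h0, h⟩))
  · rw [edgeMap_of_mem s a ⟨t', h0.trans h, h1⟩, edgeMap_of_mem s a ⟨t, h0, h.trans h1⟩]
    have hs : SameEdge (edge s a ⟨t, h0, h.trans h1⟩) (edge s a ⟨t', h0.trans h, h1⟩) := ⟨rfl, rfl⟩
    refine hs.pathDist_le.trans ?_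
    simp only [pos]
    rw [abs_sub_comm, abs_of_nonneg (by linarith)]

/-- A segment of an edge is a geodesic as soon as it is not longer than the distance of its ends. -/
theorem edgeMap_geodesic (s : S) (a : A) {t t' : ℝ} (ht : t ∈ Set.Icc (0 : ℝ) 1)
    (ht' : t' ∈ Set.Icc (0 : ℝ) 1) (h : t ≤ t')
    (hd : t' - t ≤ dist (edgeMap A hA s a t) (edgeMap A hA s a t')) :
    ∃ γ, IsGeodesic γ (edgeMap A hA s a t) (edgeMap A hA s a t') := by
  have hd' := le_antisymm (dist_edgeMap_le s a ht ht' h) hd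
  have main : ∀ x ∈ Set.Icc 0 (t' - t), ∀ y ∈ Set.Icc 0 (t' - t), x ≤ y →
      dist (edgeMap A hA s a (t + x)) (edgeMap A hA s a (t + y)) = y - x := by
    intro x hx y hy hxy
    have hx' : t + x ∈ Set.Icc (0 : ℝ) 1 := ⟨by linarith [ht.1, hx.1], by linarith [ht'.2, hx.2]⟩
    have hy' : t + y ∈ Set.Icc (0 : ℝ) 1 := ⟨by linarith [ht.1, hy.1], by linarith [ht'.2, hy.2]⟩
    have i1 := dist_edgeMap_le (hA := hA) s a ht hx' (by linarith [hx.1])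
    have i2 := dist_edgeMap_le (hA := hA) s a hx' hy' (by linarith)
    have i3 := dist_edgeMap_le (hA := hA) s a hy' ht' (by linarith [hy.2])
    have i4 := dist_triangle4 (edgeMap A hA s a t) (edgeMap A hA s a (t + x))
      (edgeMap A hA s a (t + y)) (edgeMap A hA s a t')
    linarith
  refine ⟨fun x => edgeMap A hA s a (t + x), by simp, by simp [hd'], ?_⟩
  rw [hd']
  intro x hx y hy
  rcases le_total x y with hxy | hxy
  · rw [main x hx y hy hxy, abs_sub_comm, abs_of_nonneg (by linarith)]
  · rw [dist_comm, main y hy x hx hxy, abs_of_nonneg (by linarith)]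

theorem exists_geodesic_symm {x y : CayleySpace A hA} (h : ∃ γ, IsGeodesic γ x y) :
    ∃ γ, IsGeodesic γ y x :=
  let ⟨_, hγ⟩ := h
  ⟨_, hγ.symm⟩

theorem exists_geodesic_trans {x y z : CayleySpace A hA} (h : ∃ γ, IsGeodesic γ x y)
    (k : ∃ γ, IsGeodesic γ y z) (hd : dist x y + dist y z ≤ dist x z) :
    ∃ γ, IsGeodesic γ x z :=
  let ⟨_, hγ⟩ := h
  let ⟨_, hη⟩ := k
  ⟨_, hγ.concat hη hd⟩

theorem exists_geodesic_of_adj {u v : S} (h : (cayleyGraph A).Adj u v) :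
    ∃ γ, IsGeodesic γ (ofVertex A hA u) (ofVertex A hA v) := by
  have main : ∀ (s : S) (a : A), (cayleyGraph A).Adj s (s * a) →
      ∃ γ, IsGeodesic γ (ofVertex A hA s) (ofVertex A hA (s * a)) := by
    intro s a h
    rw [← edgeMap_zero s a, ← edgeMap_one s a]
    refine edgeMap_geodesic s a (by simp) (by simp) zero_le_one ?_
    rw [edgeMap_zero, edgeMap_one, dist_ofVertex, vertexDist, SimpleGraph.dist_eq_one_iff_adj.2 h]
    simp
  obtain ⟨_, ⟨a, ha, rfl⟩ | ⟨a, ha, rfl⟩⟩ := id h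
  · exact main u ⟨a, ha⟩ h
  · exact exists_geodesic_symm (main v ⟨a, ha⟩ h.symm)

theorem exists_geodesic_ofVertex (u v : S) :
    ∃ γ, IsGeodesic γ (ofVertex A hA u) (ofVertex A hA v) := by
  obtain ⟨w, hw⟩ := (cayleyGraph_connected hA).exists_walk_length_eq_dist u v
  induction w with
  | nil => exact ⟨_, IsGeodesic.refl _⟩
  | @cons u x v hadj p ih =>
    have h1 : (cayleyGraph A).dist x v ≤ p.length := SimpleGraph.dist_le p
    have h2 := (cayleyGraph_connected hA).dist_triangle (u := u) (v := x) (w := v)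
    have h3 := SimpleGraph.dist_eq_one_iff_adj.2 hadj
    rw [SimpleGraph.Walk.length_cons] at hw
    refine exists_geodesic_trans (exists_geodesic_of_adj hadj) (ih (by omega)) ?_
    simp only [dist_ofVertex, vertexDist]
    exact_mod_cast (by omega)

theorem exists_geodesic_src (p : CayleyPoint A)
    (h : pos p ≤ dist (α := CayleySpace A hA) p (ofVertex A hA (src p))) :
    ∃ γ, IsGeodesic (X := CayleySpace A hA) γ p (ofVertex A hA (src p)) := by
  cases p with
  | vertex s => exact exists_geodesic_ofVertex s s
  | edge s a t =>
    apply exists_geodesic_symm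
    have e := edgeMap_of_mem (hA := hA) s a t
    simp only [src, pos] at h ⊢
    rw [← e, ← edgeMap_zero s a] at h ⊢
    refine edgeMap_geodesic s a (by simp) (Set.Ioo_subset_Icc_self t.2) t.2.1.le ?_
    rw [dist_comm, sub_zero]
    exact h

theorem exists_geodesic_tgt (p : CayleyPoint A)
    (h : rem p ≤ dist (α := CayleySpace A hA) p (ofVertex A hA (tgt p))) :
    ∃ γ, IsGeodesic (X := CayleySpace A hA) γ p (ofVertex A hA (tgt p)) := by
  cases p with
  | vertex s => exact exists_geodesic_ofVertex s s
  | edge s a t =>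
    have e := edgeMap_of_mem (hA := hA) s a t
    simp only [tgt, rem] at h ⊢
    rw [← e, ← edgeMap_one s a] at h ⊢
    exact edgeMap_geodesic s a (Set.Ioo_subset_Icc_self t.2) (by simp) t.2.2.le h

theorem exists_end (p : CayleyPoint A) (v : S) :
    ∃ (w : S) (c : ℝ), c + vertexDist A w v ≤ toVertex p v ∧
      dist (α := CayleySpace A hA) p (ofVertex A hA w) ≤ c ∧
      (c ≤ dist (α := CayleySpace A hA) p (ofVertex A hA w) →
        ∃ γ, IsGeodesic (X := CayleySpace A hA) γ p (ofVertex A hA w)) := by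
  rcases min_cases (pos p + vertexDist A (src p) v) (rem p + vertexDist A (tgt p) v) with h | h
  · exact ⟨src p, pos p, h.1.ge, (dist_le_toVertex _ _).trans (toVertex_src p),
      exists_geodesic_src p⟩
  · exact ⟨tgt p, rem p, h.1.ge, (dist_le_toVertex _ _).trans (toVertex_tgt p),
      exists_geodesic_tgt p⟩

/-- The geometric realisation of a Cayley graph is a geodesic space. -/
theorem isGeodesicSpace (A : Set S) (hA : Submonoid.closure A = ⊤) :
    IsGeodesicSpace (CayleySpace A hA) := by
  intro p q
  rcases pathDist_cases (A := A) p q with h | ⟨h, h'⟩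
  · have hpq : dist p q = through (A := A) p q := h
    have main : ∀ (w : S) (c : ℝ), dist q (ofVertex A hA w) ≤ c →
        toVertex (A := A) p w + c = dist p q →
        (c ≤ dist q (ofVertex A hA w) → ∃ γ, IsGeodesic γ q (ofVertex A hA w)) →
        ∃ γ, IsGeodesic γ p q := by
      intro w c h1 h2 h3
      obtain ⟨v, b, k1, k2, k3⟩ := exists_end (hA := hA) p w
      have i1 := dist_triangle p (ofVertex A hA v) q
      have i2 := dist_triangle (ofVertex A hA v) (ofVertex A hA w) q
      have i4 := dist_comm (ofVertex A hA w) q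
      have i3 := dist_ofVertex (hA := hA) v w
      refine exists_geodesic_trans (k3 (by linarith)) (exists_geodesic_trans
        (exists_geodesic_ofVertex v w) (exists_geodesic_symm (h3 (by linarith))) ?_) ?_
      · linarith
      · linarith
    rcases min_choice (toVertex (A := A) p (src q) + pos q)
      (toVertex (A := A) p (tgt q) + rem q) with k | k
    · exact main (src q) (pos q) ((dist_le_toVertex _ _).trans (toVertex_src q))
        (k.symm.trans hpq.symm) (exists_geodesic_src q)
    · exact main (tgt q) (rem q) ((dist_le_toVertex _ _).trans (toVertex_tgt q))
        (k.symm.trans hpq.symm) (exists_geodesic_tgt q)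
  · cases p with
    | vertex s => exact h.elim
    | edge s a t =>
      cases q with
      | vertex s' => exact h.elim
      | edge s' a' t' =>
        obtain ⟨rfl, rfl⟩ := h
        have e := edgeMap_of_mem (hA := hA) s a t
        have e' := edgeMap_of_mem (hA := hA) s a t'
        have hd : dist (edgeMap A hA s a t) (edgeMap A hA s a t') = |(t : ℝ) - t'| := by
          rw [e, e']; exact h'
        rw [← e, ← e']
        rcases le_total (t : ℝ) t' with ht | ht
        · refine edgeMap_geodesic s a (Set.Ioo_subset_Icc_self t.2)
            (Set.Ioo_subset_Icc_self t'.2) ht ?_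
          rw [hd, abs_sub_comm]; exact le_abs_self _
        · apply exists_geodesic_symm
          refine edgeMap_geodesic s a (Set.Ioo_subset_Icc_self t'.2)
            (Set.Ioo_subset_Icc_self t.2) ht ?_
          rw [dist_comm, hd]; exact le_abs_self _

end CayleySpace

/-- The monoid `S` is hyperbolic: its Cayley graph with respect to some finite generating set is a
hyperbolic geodesic space. -/
def IsHyperbolicMonoid (S : Type u) [Monoid S] : Prop :=
  ∃ (A : Set S) (hA : Submonoid.closure A = ⊤), A.Finite ∧ IsHyperbolicSpace (CayleySpace A hA)

/-- The monoid `S` is finitely generated and of finite geometric type. -/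
def IsFiniteGeometricType (S : Type u) [Monoid S] : Prop :=
  ∃ A : Set S, A.Finite ∧ Submonoid.closure A = ⊤ ∧
    ∃ n : ℕ, ∀ q : S, ∀ a ∈ A, {x : S | x * a = q}.encard ≤ n

end Cayley

/-- The subsemigroup `T` is large in `S`, and `S` is a small extension of `T`: the Rees index
`|S - T| + 1` is finite. -/
def IsLargeSubsemigroup {S : Type u} [Mul S] (T : Subsemigroup S) : Prop :=
  ((T : Set S)ᶜ).Finite

/-!
Adjoining finitely many elements does not change the large-scale geometry of a monoid. A left
inverse `ψ : S → T` of the embedding `φ : T → S` is Lipschitz for the word metrics: for a generator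
`a` of `S`, the set `F` of all `t` with `t * a ∉ T` is finite, and every `t ∉ F` has a suffix `u` in
a fixed finite set with `u * a ∈ T`. Writing `t = v * u`, the elements `t` and `t * a = v * (u * a)`
differ by boundedly many right multiplications in `T`, starting from `v`. Hence the Cayley graphs of
`S` and `T` are quasi-isometric.

Hyperbolicity passes along quasi-isometric embeddings of geodesic spaces because quasi-geodesics in
a hyperbolic space stay close to geodesics with the same ends (the Morse lemma). Repeated bisection
shows that a geodesic is logarithmically close to any path with the same ends. At a point of the
geodesic furthest from the quasi-geodesic, say at distance `D`, one compares with the part of the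
quasi-geodesic between two of its points close to the geodesic, whose length is linear in `D`: so
`D` is at most logarithmic in `D`, hence bounded.
-/

open Filter Set

open scoped Pointwise Topology

section Geodesics

variable {X : Type*} [MetricSpace X] {x y : X} {γ : ℝ → X}

theorem IsGeodesic.dist_eq_sub (hγ : IsGeodesic γ x y) {s t : ℝ} (hs : 0 ≤ s) (hst : s ≤ t)
    (ht : t ≤ dist x y) : dist (γ s) (γ t) = t - s := by
  rw [hγ.2.2 s ⟨hs, hst.trans ht⟩ t ⟨hs.trans hst, ht⟩, abs_sub_comm,
    abs_of_nonneg (sub_nonneg.2 hst)]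

theorem IsGeodesic.left_mem_geodesicTrace (hγ : IsGeodesic γ x y) : x ∈ geodesicTrace γ x y :=
  ⟨0, left_mem_Icc.2 dist_nonneg, hγ.1⟩

theorem IsGeodesic.right_mem_geodesicTrace (hγ : IsGeodesic γ x y) : y ∈ geodesicTrace γ x y :=
  ⟨dist x y, right_mem_Icc.2 dist_nonneg, hγ.2.1⟩

theorem IsGeodesic.dist_left_le (hγ : IsGeodesic γ x y) {u : X} (hu : u ∈ geodesicTrace γ x y) :
    dist x u ≤ dist x y := by
  obtain ⟨t, ht, rfl⟩ := hu
  have h := hγ.dist_eq_sub le_rfl ht.1 ht.2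
  rw [hγ.1, sub_zero] at h
  exact h.trans_le ht.2

theorem IsGeodesic.continuousOn (hγ : IsGeodesic γ x y) : ContinuousOn γ (Icc 0 (dist x y)) := by
  have hlip : LipschitzOnWith 1 γ (Icc 0 (dist x y)) :=
    LipschitzOnWith.of_dist_le_mul fun s hs t ht => by
      rw [hγ.2.2 s hs t ht, NNReal.coe_one, one_mul, Real.dist_eq]
  exact hlip.continuousOn

theorem IsGeodesic.isCompact_geodesicTrace (hγ : IsGeodesic γ x y) :
    IsCompact (geodesicTrace γ x y) :=
  isCompact_Icc.image_of_continuousOn hγ.continuousOn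

theorem IsGeodesic.isPreconnected_geodesicTrace (hγ : IsGeodesic γ x y) :
    IsPreconnected (geodesicTrace γ x y) :=
  isPreconnected_Icc.image γ hγ.continuousOn

theorem IsGeodesic.exists_segment (hγ : IsGeodesic γ x y) {a t b : ℝ} (ha : 0 ≤ a) (hat : a ≤ t)
    (htb : t ≤ b) (hb : b ≤ dist x y) :
    ∃ η, IsGeodesic η (γ a) (γ b) ∧ γ t ∈ geodesicTrace η (γ a) (γ b) := by
  have hab : dist (γ a) (γ b) = b - a := hγ.dist_eq_sub ha (hat.trans htb) hb
  refine ⟨fun s => γ (a + s), ⟨by simp, by simp [hab], fun s hs s' hs' => ?_⟩, t - a, ?_, by simp⟩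
  · rw [hab] at hs hs'
    rw [hγ.2.2 _ ⟨by linarith [hs.1], by linarith [hs.2]⟩ _
      ⟨by linarith [hs'.1], by linarith [hs'.2]⟩, add_sub_add_left_eq_sub]
  · rw [hab]
    exact ⟨by linarith, by linarith⟩

/-- The point `γ a` is either at distance `2 * r` from `γ t`, or the initial point of `γ`; in both
cases the ball around `γ a` through the point `v` of `V` avoids the `r`-ball around `γ t` outside
`V`. -/
theorem IsGeodesic.exists_near_left (hγ : IsGeodesic γ x y) {t : ℝ} (ht : t ∈ Icc 0 (dist x y))
    {V : Set X} {r : ℝ} (hr : 0 ≤ r) (hx : x ∈ V)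
    (hV : ∀ s ∈ Icc 0 (dist x y), ∃ v ∈ V, dist (γ s) v ≤ r) :
    ∃ a ∈ Icc 0 t, t - a ≤ 2 * r ∧ ∃ v ∈ V, dist (γ a) v ≤ r ∧
      ∀ w, dist (γ a) w ≤ dist (γ a) v → w ∈ V ∨ r ≤ dist (γ t) w := by
  by_cases h : 2 * r ≤ t
  · obtain ⟨v, hv, hav⟩ := hV (t - 2 * r) ⟨by linarith, by linarith [ht.2]⟩
    refine ⟨t - 2 * r, ⟨by linarith, by linarith⟩, by linarith, v, hv, hav, fun w hw => Or.inr ?_⟩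
    have hat := hγ.dist_eq_sub (s := t - 2 * r) (t := t) (by linarith) (by linarith) ht.2
    linarith [dist_triangle_right (γ (t - 2 * r)) (γ t) w]
  · refine ⟨0, ⟨le_rfl, ht.1⟩, by linarith, x, hx, by rwa [hγ.1, dist_self], fun w hw => Or.inl ?_⟩
    rw [hγ.1, dist_self, dist_le_zero] at hw
    exact hw ▸ hx

theorem IsGeodesic.exists_near_right (hγ : IsGeodesic γ x y) {t : ℝ} (ht : t ∈ Icc 0 (dist x y))
    {V : Set X} {r : ℝ} (hr : 0 ≤ r) (hy : y ∈ V)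
    (hV : ∀ s ∈ Icc 0 (dist x y), ∃ v ∈ V, dist (γ s) v ≤ r) :
    ∃ b ∈ Icc t (dist x y), b - t ≤ 2 * r ∧ ∃ v ∈ V, dist (γ b) v ≤ r ∧
      ∀ w, dist (γ b) w ≤ dist (γ b) v → w ∈ V ∨ r ≤ dist (γ t) w := by
  have hflip : ∀ {s : ℝ}, s ∈ Icc 0 (dist x y) → dist x y - s ∈ Icc 0 (dist x y) :=
    fun hs => ⟨sub_nonneg.2 hs.2, sub_le_self _ hs.1⟩
  obtain ⟨a, ha, hat, v, hv, hav, hfar⟩ := hγ.symm.exists_near_left (t := dist x y - t)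
    (by rw [dist_comm y x]; exact hflip ht) hr hy
    fun s hs => hV _ (hflip (by rwa [dist_comm y x] at hs))
  rw [sub_sub_cancel] at hfar
  exact ⟨dist x y - a, ⟨by linarith [ha.2], by linarith [ha.1]⟩, by linarith, v, hv, hav, hfar⟩

theorem IsGeodesic.exists_forall_dist_le_infDist_add_one (hγ : IsGeodesic γ x y) {V : Set X}
    (hV : V.Nonempty) :
    ∃ p ∈ geodesicTrace γ x y, ∀ u ∈ geodesicTrace γ x y, ∃ v ∈ V,
      dist u v ≤ Metric.infDist p V + 1 := by
  obtain ⟨p, hp, hmax⟩ := hγ.isCompact_geodesicTrace.exists_isMaxOn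
    ⟨x, hγ.left_mem_geodesicTrace⟩ (Metric.continuous_infDist_pt V).continuousOn
  refine ⟨p, hp, fun u hu => ?_⟩
  obtain ⟨v, hv, huv⟩ := (Metric.infDist_lt_iff hV).1 ((hmax hu).trans_lt (lt_add_one _))
  exact ⟨v, hv, huv.le⟩

end Geodesics

section Growth

theorem eventually_linear_lt_two_pow (A B : ℝ) : ∀ᶠ m : ℕ in atTop, A + B * m < 2 ^ m := by
  have hconst : Tendsto (fun m : ℕ => A / 2 ^ m) atTop (𝓝 0) :=
    (tendsto_pow_atTop_atTop_of_one_lt one_lt_two).const_div_atTop A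
  have hlin : Tendsto (fun m : ℕ => (m : ℝ) / 2 ^ m) atTop (𝓝 0) := by
    simpa using tendsto_pow_const_div_const_pow_of_one_lt 1 (one_lt_two (α := ℝ))
  have hsum := hconst.add (hlin.const_mul B)
  rw [mul_zero, add_zero] at hsum
  filter_upwards [hsum.eventually_lt_const one_pos] with m hm
  rwa [← mul_div_assoc, ← add_div, div_lt_one (by positivity)] at hm

theorem exists_bound_of_le_linear_of_le_log {A : ℝ} (hA : 0 ≤ A) (B c d : ℝ) :
    ∃ R : ℝ, ∀ D N : ℝ, N ≤ A * D + B → (∀ m : ℕ, N ≤ 2 ^ m → D ≤ c + d * m) → D ≤ R := by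
  obtain ⟨m₀, hm₀⟩ := eventually_atTop.1
    (eventually_linear_lt_two_pow (A * (c + d) + B) (A * d))
  refine ⟨c + d * m₀, fun D N hlin hlog => hlog m₀ ?_⟩
  have descend : ∀ m ≥ m₀, N ≤ 2 ^ (m + 1) → N ≤ 2 ^ m := by
    intro m hm hN
    have hD := mul_le_mul_of_nonneg_left (hlog (m + 1) hN) hA
    push_cast at hD
    linarith [hm₀ m hm]
  obtain ⟨k, hk⟩ := pow_unbounded_of_one_lt N one_lt_two
  have hmax : N ≤ 2 ^ max m₀ k :=
    hk.le.trans (pow_le_pow_right₀ one_le_two (le_max_right m₀ k))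
  exact Nat.decreasingInduction' (P := fun m => N ≤ 2 ^ m) (fun m _ hm => descend m hm)
    (le_max_left m₀ k) hmax

end Growth

section MorseLemma

variable {X Y : Type*} [MetricSpace X] [MetricSpace Y] {δ K : ℝ}

/-- The map `f` is a quasi-isometric embedding of the subset `s`. A single constant `K` serves both
as the multiplicative and as the additive constant. For `s` an interval in `ℝ` this is the notion of
a quasi-geodesic, which is not required to be continuous. -/
structure QuasiIsometricOn (K : ℝ) (f : Y → X) (s : Set Y) : Prop where
  dist_map_le : ∀ p ∈ s, ∀ q ∈ s, dist (f p) (f q) ≤ K * dist p q + K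
  dist_le_map : ∀ p ∈ s, ∀ q ∈ s, dist p q ≤ K * dist (f p) (f q) + K

theorem QuasiIsometricOn.nonneg {f : Y → X} {s : Set Y} (hf : QuasiIsometricOn K f s)
    (hs : s.Nonempty) : 0 ≤ K := by
  obtain ⟨p, hp⟩ := hs
  simpa using hf.dist_map_le p hp p hp

theorem QuasiIsometricOn.dist_map_le_two_mul {f : Y → X} {s : Set Y} (hf : QuasiIsometricOn K f s)
    {p q : Y} (hp : p ∈ s) (hq : q ∈ s) (hpq : dist p q ≤ 1) : dist (f p) (f q) ≤ 2 * K := by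
  linarith [hf.dist_map_le p hp q hq, mul_le_mul_of_nonneg_left hpq (hf.nonneg ⟨p, hp⟩)]

theorem QuasiIsometricOn.comp_isGeodesic {f : Y → X} (hf : QuasiIsometricOn K f univ) {x y : Y}
    {α : ℝ → Y} (hα : IsGeodesic α x y) : QuasiIsometricOn K (f ∘ α) (Icc 0 (dist x y)) where
  dist_map_le s hs t ht := by
    simpa only [Function.comp_apply, Real.dist_eq, hα.2.2 s hs t ht] using
      hf.dist_map_le (α s) trivial (α t) trivial
  dist_le_map s hs t ht := by
    simpa only [Function.comp_apply, Real.dist_eq, hα.2.2 s hs t ht] using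
      hf.dist_le_map (α s) trivial (α t) trivial

theorem HasThinTriangles.nonneg (hδ : HasThinTriangles X δ) (x : X) : 0 ≤ δ := by
  have hx := IsGeodesic.refl x
  obtain ⟨w, -, hw⟩ := hδ x x x _ _ _ hx hx hx x hx.left_mem_geodesicTrace
  exact dist_nonneg.trans hw.le

theorem HasThinTriangles.quadrilateral (hδ : HasThinTriangles X δ) (hX : IsGeodesicSpace X)
    {a b c d : X} {α β γ η : ℝ → X} (hα : IsGeodesic α a b) (hβ : IsGeodesic β a d)
    (hγ : IsGeodesic γ d c) (hη : IsGeodesic η b c) {u : X} (hu : u ∈ geodesicTrace α a b) :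
    ∃ w ∈ geodesicTrace β a d ∪ geodesicTrace γ d c ∪ geodesicTrace η b c, dist u w ≤ 2 * δ := by
  have hδ₀ := hδ.nonneg u
  obtain ⟨diagonal, hdiagonal⟩ := hX c a
  obtain ⟨w, hw | hw, huw⟩ := hδ _ _ _ _ _ _ hα hη hdiagonal u hu
  · exact ⟨w, Or.inr hw, by linarith⟩
  · obtain ⟨w', hw', hww'⟩ := hδ _ _ _ _ _ _ hdiagonal hβ hγ w hw
    exact ⟨w', Or.inl hw', by linarith [dist_triangle u w w']⟩

theorem HasThinTriangles.exists_dist_le_of_abs_sub_le_two_pow (hδ : HasThinTriangles X δ)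
    (hX : IsGeodesicSpace X) {I : Set ℝ} (hI : Convex ℝ I) {q : ℝ → X} {C : ℝ}
    (hq : ∀ s ∈ I, ∀ t ∈ I, |s - t| ≤ 1 → dist (q s) (q t) ≤ C) (m : ℕ) :
    ∀ a ∈ I, ∀ b ∈ I, |a - b| ≤ 2 ^ m → ∀ γ, IsGeodesic γ (q a) (q b) →
      ∀ u ∈ geodesicTrace γ (q a) (q b), ∃ s ∈ I, dist u (q s) ≤ C + δ * m := by
  induction m with
  | zero =>
    intro a ha b hb hab γ hγ u hu
    refine ⟨a, ha, ?_⟩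
    rw [dist_comm, Nat.cast_zero, mul_zero, add_zero]
    exact (hγ.dist_left_le hu).trans (hq a ha b hb (by simpa using hab))
  | succ m ih =>
    intro a ha b hb hab γ hγ u hu
    have hmid : midpoint ℝ a b ∈ I := hI.midpoint_mem ha hb
    have hleft : |midpoint ℝ a b - a| ≤ 2 ^ m := by
      rw [← Real.dist_eq, dist_midpoint_left, Real.dist_eq, Real.norm_ofNat]
      rw [pow_succ] at hab
      linarith
    have hright : |b - midpoint ℝ a b| ≤ 2 ^ m := by
      rw [← Real.dist_eq, dist_right_midpoint, Real.dist_eq, Real.norm_ofNat]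
      rw [pow_succ] at hab
      linarith
    obtain ⟨β, hβ⟩ := hX (q b) (q (midpoint ℝ a b))
    obtain ⟨α, hα⟩ := hX (q (midpoint ℝ a b)) (q a)
    obtain ⟨w, hw, huw⟩ := hδ _ _ _ _ _ _ hγ hβ hα u hu
    obtain ⟨s, hs, hws⟩ : ∃ s ∈ I, dist w (q s) ≤ C + δ * m := by
      rcases hw with hw | hw
      · exact ih b hb _ hmid hright β hβ w hw
      · exact ih _ hmid a ha hleft α hα w hw
    refine ⟨s, hs, (dist_triangle u w (q s)).trans ?_⟩
    push_cast
    linarith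

/-- The detour leaves the geodesic at most `2 * r` before `p`, follows a geodesic `θ` between two
points of `V`, and returns at most `2 * r` after `p`. -/
theorem HasThinTriangles.exists_detour (hδ : HasThinTriangles X δ) (hX : IsGeodesicSpace X)
    {x y : X} {γ : ℝ → X} (hγ : IsGeodesic γ x y) {V : Set X} {r : ℝ} (hx : x ∈ V) (hy : y ∈ V)
    (hV : ∀ u ∈ geodesicTrace γ x y, ∃ v ∈ V, dist u v ≤ r) {p : X}
    (hp : p ∈ geodesicTrace γ x y) :
    ∃ v ∈ V, ∃ v' ∈ V, dist v v' ≤ 6 * r ∧ ∀ θ, IsGeodesic θ v v' →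
      r ≤ 2 * δ ∨ ∃ w ∈ V ∪ geodesicTrace θ v v', dist p w ≤ 2 * δ := by
  have hr : 0 ≤ r := by
    obtain ⟨v, -, hv⟩ := hV p hp
    exact dist_nonneg.trans hv
  have hV' : ∀ s ∈ Icc 0 (dist x y), ∃ v ∈ V, dist (γ s) v ≤ r := fun s hs => hV _ ⟨s, hs, rfl⟩
  obtain ⟨t, ht, rfl⟩ := hp
  obtain ⟨a, ha, hat, v, hv, hav, hva⟩ := hγ.exists_near_left ht hr hx hV'
  obtain ⟨b, hb, hbt, v', hv', hbv', hvb⟩ := hγ.exists_near_right ht hr hy hV'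
  refine ⟨v, hv, v', hv', ?_, fun θ hθ => ?_⟩
  · have hab := hγ.dist_eq_sub ha.1 (ha.2.trans hb.1) hb.2
    linarith [dist_triangle4_left (γ a) (γ b) v v']
  obtain ⟨α, hα, hpα⟩ := hγ.exists_segment ha.1 ha.2 hb.1 hb.2
  obtain ⟨β, hβ⟩ := hX (γ a) v
  obtain ⟨η, hη⟩ := hX (γ b) v'
  have conclude : ∀ w, dist (γ t) w ≤ 2 * δ → (w ∈ V ∨ r ≤ dist (γ t) w) →
      r ≤ 2 * δ ∨ ∃ w ∈ V ∪ geodesicTrace θ v v', dist (γ t) w ≤ 2 * δ := by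
    rintro w hw (hwV | hrw)
    · exact Or.inr ⟨w, Or.inl hwV, hw⟩
    · exact Or.inl (hrw.trans hw)
  obtain ⟨w, (hw | hw) | hw, hpw⟩ := hδ.quadrilateral hX hα hβ hθ hη hpα
  · exact conclude w hpw (hva w (hβ.dist_left_le hw))
  · exact Or.inr ⟨w, Or.inr hw, hpw⟩
  · exact conclude w hpw (hvb w (hη.dist_left_le hw))

theorem HasThinTriangles.exists_geodesic_near_quasiGeodesic (hδ : HasThinTriangles X δ)
    (hX : IsGeodesicSpace X) (hK : 0 ≤ K) :
    ∃ R : ℝ, ∀ (q : ℝ → X) (L : ℝ) (γ : ℝ → X), 0 ≤ L → QuasiIsometricOn K q (Icc 0 L) →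
      IsGeodesic γ (q 0) (q L) → ∀ u ∈ geodesicTrace γ (q 0) (q L),
        ∃ s ∈ Icc 0 L, dist u (q s) ≤ R := by
  obtain ⟨R, hR⟩ := exists_bound_of_le_linear_of_le_log (A := 6 * K) (by positivity) (7 * K)
    (2 * δ + 2 * K) δ
  refine ⟨R + 1, fun q L γ hL hq hγ => ?_⟩
  set V : Set X := q '' Icc 0 L
  have hV₀ : q 0 ∈ V := ⟨0, left_mem_Icc.2 hL, rfl⟩
  have hV₁ : q L ∈ V := ⟨L, right_mem_Icc.2 hL, rfl⟩
  obtain ⟨p, hp, hnear⟩ := hγ.exists_forall_dist_le_infDist_add_one ⟨_, hV₀⟩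
  set D := Metric.infDist p V
  suffices hDR : D ≤ R by
    intro u hu
    obtain ⟨_, ⟨s, hs, rfl⟩, hus⟩ := hnear u hu
    exact ⟨s, hs, hus.trans (by linarith)⟩
  obtain ⟨_, ⟨a, ha, rfl⟩, _, ⟨b, hb, rfl⟩, hab, hdetour⟩ :=
    hδ.exists_detour hX hγ hV₀ hV₁ hnear hp
  obtain ⟨θ, hθ⟩ := hX (q a) (q b)
  refine hR D |a - b| ?_ fun m hm => ?_
  · have hlin := hq.dist_le_map a ha b hb
    rw [Real.dist_eq] at hlin
    linarith [mul_le_mul_of_nonneg_left hab hK]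
  have hδm : 0 ≤ δ * m := mul_nonneg (hδ.nonneg p) m.cast_nonneg
  rcases hdetour θ hθ with hD | ⟨w, hw | hw, hpw⟩
  · linarith
  · have hDw := Metric.infDist_le_dist_of_mem (x := p) hw
    linarith
  · obtain ⟨s, hs, hws⟩ := hδ.exists_dist_le_of_abs_sub_le_two_pow hX (convex_Icc 0 L)
      (fun s hs t ht hst => hq.dist_map_le_two_mul hs ht hst) m a ha b hb hm θ hθ w hw
    have hDs : D ≤ dist p (q s) := Metric.infDist_le_dist_of_mem ⟨s, hs, rfl⟩
    linarith [dist_triangle p w (q s)]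

theorem exists_dist_lt_of_isPreconnected {s A B : Set X} (hs : IsPreconnected s)
    (hcover : s ⊆ A ∪ B) (hA : (s ∩ A).Nonempty) (hB : (s ∩ B).Nonempty) {ε : ℝ} (hε : 0 < ε) :
    ∃ a ∈ A, ∃ b ∈ B, dist a b < ε := by
  obtain ⟨z, -, hzA, hzB⟩ := isPreconnected_closed_iff.1 hs (closure A) (closure B)
    isClosed_closure isClosed_closure
    (hcover.trans (union_subset_union subset_closure subset_closure))
    (hA.mono (inter_subset_inter_right s subset_closure))
    (hB.mono (inter_subset_inter_right s subset_closure))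
  obtain ⟨a, ha, hza⟩ := Metric.mem_closure_iff.1 hzA (ε / 2) (half_pos hε)
  obtain ⟨b, hb, hzb⟩ := Metric.mem_closure_iff.1 hzB (ε / 2) (half_pos hε)
  exact ⟨a, ha, b, hb, (dist_triangle_left a b z).trans_lt (by linarith)⟩

theorem HasThinTriangles.exists_quasiGeodesic_near_geodesic (hδ : HasThinTriangles X δ)
    (hX : IsGeodesicSpace X) (hK : 0 ≤ K) :
    ∃ R : ℝ, ∀ (q : ℝ → X) (L : ℝ) (γ : ℝ → X), 0 ≤ L → QuasiIsometricOn K q (Icc 0 L) →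
      IsGeodesic γ (q 0) (q L) → ∀ s ∈ Icc 0 L,
        ∃ u ∈ geodesicTrace γ (q 0) (q L), dist (q s) u ≤ R := by
  obtain ⟨R, hR⟩ := hδ.exists_geodesic_near_quasiGeodesic hX hK
  refine ⟨K * (K * (2 * R + 1) + K) + K + R, fun q L γ hL hq hγ s hs => ?_⟩
  have hnear := hR q L γ hL hq hγ
  have hR₀ : 0 ≤ R := by
    obtain ⟨_, -, h⟩ := hnear _ hγ.left_mem_geodesicTrace
    exact dist_nonneg.trans h
  -- The geodesic is connected, so two adjacent points of it are close to `q` before and after `s`.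
  obtain ⟨u, ⟨hu, i, hi, hui⟩, v, ⟨j, hj, hvj⟩, huv⟩ := exists_dist_lt_of_isPreconnected
    (A := {u ∈ geodesicTrace γ (q 0) (q L) | ∃ i ∈ Icc 0 s, dist u (q i) ≤ R})
    (B := {v | ∃ j ∈ Icc s L, dist v (q j) ≤ R}) hγ.isPreconnected_geodesicTrace
    (fun u hu => by
      obtain ⟨t, ht, hut⟩ := hnear u hu
      rcases le_total t s with hts | hst
      · exact Or.inl ⟨hu, t, ⟨ht.1, hts⟩, hut⟩
      · exact Or.inr ⟨t, ⟨hst, ht.2⟩, hut⟩)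
    ⟨q 0, hγ.left_mem_geodesicTrace, hγ.left_mem_geodesicTrace, 0, left_mem_Icc.2 hs.1, by simpa⟩
    ⟨q L, hγ.right_mem_geodesicTrace, L, right_mem_Icc.2 hs.2, by simpa⟩ one_pos
  have hiL : i ∈ Icc 0 L := ⟨hi.1, hi.2.trans hs.2⟩
  have hij : dist (q i) (q j) ≤ 2 * R + 1 := by
    linarith [dist_triangle4_left u v (q i) (q j)]
  have hsi : s - i ≤ K * (2 * R + 1) + K := by
    have hqij := hq.dist_le_map i hiL j ⟨hs.1.trans hj.1, hj.2⟩
    rw [Real.dist_eq, abs_sub_comm, abs_of_nonneg (by linarith [hi.2, hj.1])] at hqij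
    linarith [mul_le_mul_of_nonneg_left hij hK, hj.1]
  have hqsi := hq.dist_map_le s hs i hiL
  rw [Real.dist_eq, abs_of_nonneg (sub_nonneg.2 hi.2)] at hqsi
  refine ⟨u, hu, ?_⟩
  linarith [mul_le_mul_of_nonneg_left hsi hK, dist_triangle_right (q s) u (q i)]

theorem HasThinTriangles.exists_geodesicTrace_near (hδ : HasThinTriangles X δ)
    (hX : IsGeodesicSpace X) (hK : 0 ≤ K) {f : Y → X} (hf : QuasiIsometricOn K f univ) :
    ∃ R : ℝ, ∀ (x y : Y) (α : ℝ → Y) (α' : ℝ → X), IsGeodesic α x y →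
      IsGeodesic α' (f x) (f y) →
        (∀ u ∈ geodesicTrace α x y, ∃ w ∈ geodesicTrace α' (f x) (f y), dist (f u) w ≤ R) ∧
        ∀ w ∈ geodesicTrace α' (f x) (f y), ∃ u ∈ geodesicTrace α x y, dist w (f u) ≤ R := by
  obtain ⟨R₁, hR₁⟩ := hδ.exists_quasiGeodesic_near_geodesic hX hK
  obtain ⟨R₂, hR₂⟩ := hδ.exists_geodesic_near_quasiGeodesic hX hK
  refine ⟨max R₁ R₂, fun x y α α' hα hα' => ?_⟩
  have hq := hf.comp_isGeodesic hα
  have h₀ : (f ∘ α) 0 = f x := congrArg f hα.1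
  have h₁ : (f ∘ α) (dist x y) = f y := congrArg f hα.2.1
  rw [← h₀, ← h₁] at hα' ⊢
  constructor
  · rintro _ ⟨s, hs, rfl⟩
    obtain ⟨w, hw, hsw⟩ := hR₁ _ _ α' dist_nonneg hq hα' s hs
    exact ⟨w, hw, hsw.trans (le_max_left _ _)⟩
  · intro w hw
    obtain ⟨s, hs, hws⟩ := hR₂ _ _ α' dist_nonneg hq hα' w hw
    exact ⟨α s, ⟨s, hs, rfl⟩, hws.trans (le_max_right _ _)⟩

theorem IsHyperbolicSpace.of_quasiIsometricOn_univ (hX : IsHyperbolicSpace X)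
    (hY : IsGeodesicSpace Y) {f : Y → X} (hf : QuasiIsometricOn K f univ) :
    IsHyperbolicSpace Y := by
  obtain ⟨hX, δ, hδ⟩ := hX
  rcases isEmpty_or_nonempty Y with hempty | hne
  · exact ⟨hY, 0, fun x => (hempty.false x).elim⟩
  have hK : 0 ≤ K := hf.nonneg univ_nonempty
  obtain ⟨R, hR⟩ := hδ.exists_geodesicTrace_near hX hK hf
  refine ⟨hY, K * (2 * R + δ) + K + 1, fun x y z α β γ hα hβ hγ u hu => ?_⟩
  obtain ⟨α', hα'⟩ := hX (f x) (f y)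
  obtain ⟨β', hβ'⟩ := hX (f y) (f z)
  obtain ⟨γ', hγ'⟩ := hX (f z) (f x)
  obtain ⟨w, hw, huw⟩ := (hR x y α α' hα hα').1 u hu
  obtain ⟨w', hw', hww'⟩ := hδ _ _ _ _ _ _ hα' hβ' hγ' w hw
  obtain ⟨v, hv, hwv⟩ : ∃ v ∈ geodesicTrace β y z ∪ geodesicTrace γ z x, dist w' (f v) ≤ R := by
    rcases hw' with hw' | hw'
    · obtain ⟨v, hv, hwv⟩ := (hR y z β β' hβ hβ').2 w' hw'
      exact ⟨v, Or.inl hv, hwv⟩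
    · obtain ⟨v, hv, hwv⟩ := (hR z x γ γ' hγ hγ').2 w' hw'
      exact ⟨v, Or.inr hv, hwv⟩
  have hfuv : dist (f u) (f v) ≤ 2 * R + δ := by
    linarith [dist_triangle4 (f u) w w' (f v)]
  refine ⟨v, hv, ?_⟩
  linarith [hf.dist_le_map u trivial v trivial, mul_le_mul_of_nonneg_left hfuv hK]

end MorseLemma

section CayleyGraphs

variable {S T : Type*} [Monoid S] [Monoid T] {A : Set S} {B : Set T}

theorem vertexDist_mul_right_le_one (s : S) {a : S} (ha : a ∈ A) : vertexDist A s (s * a) ≤ 1 := by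
  by_cases h : s = s * a
  · rw [← h, CayleyPoint.vertexDist_self]
    exact zero_le_one
  · have hadj : (cayleyGraph A).Adj s (s * a) := ⟨h, Or.inl ⟨a, ha, rfl⟩⟩
    rw [vertexDist, SimpleGraph.dist_eq_one_iff_adj.2 hadj, Nat.cast_one]

theorem exists_vertexDist_mul_right_le (hA : Submonoid.closure A = ⊤) (u : S) :
    ∃ K : ℝ, ∀ s : S, vertexDist A s (s * u) ≤ K := by
  induction u using Submonoid.induction_of_closure_eq_top_right hA with
  | one => exact ⟨0, fun s => by rw [mul_one, CayleyPoint.vertexDist_self]⟩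
  | mul_right u a ha ih =>
    obtain ⟨K, hK⟩ := ih
    refine ⟨K + 1, fun s => ?_⟩
    rw [← mul_assoc]
    exact (CayleyPoint.vertexDist_triangle hA _ (s * u) _).trans
      (add_le_add (hK s) (vertexDist_mul_right_le_one _ ha))

theorem eventually_vertexDist_mul_mul_le (hA : Submonoid.closure A = ⊤) (u w : S) :
    ∀ᶠ K : ℝ in atTop, ∀ s : S, vertexDist A (s * u) (s * w) ≤ K := by
  obtain ⟨K, hK⟩ := exists_vertexDist_mul_right_le hA u
  obtain ⟨K', hK'⟩ := exists_vertexDist_mul_right_le hA w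
  filter_upwards [eventually_ge_atTop (K + K')] with M hM s
  have htri := CayleyPoint.vertexDist_triangle hA (s * u) s (s * w)
  rw [CayleyPoint.vertexDist_comm (s * u) s] at htri
  linarith [hK s, hK' s]

theorem vertexDist_map_le (hA : Submonoid.closure A = ⊤) (hB : Submonoid.closure B = ⊤)
    (h : S → T) {K : ℝ} (hK : ∀ a ∈ A, ∀ s, vertexDist B (h s) (h (s * a)) ≤ K) (u v : S) :
    vertexDist B (h u) (h v) ≤ K * vertexDist A u v := by
  have hwalk : ∀ {u v : S} (p : (cayleyGraph A).Walk u v),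
      vertexDist B (h u) (h v) ≤ K * p.length := by
    intro u v p
    induction p with
    | nil => simp [CayleyPoint.vertexDist_self]
    | @cons u x v hadj p ih =>
      have hstep : vertexDist B (h u) (h x) ≤ K := by
        obtain ⟨-, ⟨a, ha, rfl⟩ | ⟨a, ha, rfl⟩⟩ := hadj
        · exact hK a ha u
        · rw [CayleyPoint.vertexDist_comm]
          exact hK a ha x
      rw [SimpleGraph.Walk.length_cons, Nat.cast_succ]
      linarith [CayleyPoint.vertexDist_triangle hB (h u) (h x) (h v)]
  obtain ⟨p, hp⟩ := (cayleyGraph_connected hA).exists_walk_length_eq_dist u v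
  rw [vertexDist.eq_def A, ← hp]
  exact hwalk p

theorem eventually_vertexDist_map_le (hA : Submonoid.closure A = ⊤) (hAf : A.Finite)
    (hB : Submonoid.closure B = ⊤) (h : S → T)
    (hbdd : ∀ a ∈ A, ∀ᶠ K : ℝ in atTop, ∀ s, vertexDist B (h s) (h (s * a)) ≤ K) :
    ∀ᶠ K : ℝ in atTop, ∀ u v, vertexDist B (h u) (h v) ≤ K * vertexDist A u v :=
  ((eventually_all_finite hAf).2 hbdd).mono fun _ => vertexDist_map_le hA hB h

theorem CayleySpace.dist_ofVertex_src_le {hA : Submonoid.closure A = ⊤} (p : CayleySpace A hA) :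
    dist p (ofVertex A hA (CayleyPoint.src p)) ≤ 1 := by
  refine (dist_le_toVertex _ _).trans ((CayleyPoint.toVertex_src _).trans ?_)
  cases p with
  | vertex s => exact zero_le_one
  | edge s a t => exact t.2.2.le

theorem CayleySpace.abs_dist_sub_vertexDist_src_le {hA : Submonoid.closure A = ⊤}
    (p q : CayleySpace A hA) :
    |dist p q - vertexDist A (CayleyPoint.src p) (CayleyPoint.src q)| ≤ 2 := by
  rw [← dist_ofVertex (hA := hA), ← Real.dist_eq]
  refine (dist_dist_dist_le p q _ _).trans ?_
  linarith [dist_ofVertex_src_le p, dist_ofVertex_src_le q]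

theorem IsHyperbolicSpace.of_vertexDist_le {hA : Submonoid.closure A = ⊤}
    {hB : Submonoid.closure B = ⊤} (hyp : IsHyperbolicSpace (CayleySpace A hA)) {K : ℝ}
    {h : T → S} {g : S → T} (hh : ∀ u v, vertexDist A (h u) (h v) ≤ K * vertexDist B u v)
    (hg : ∀ u v, vertexDist B (g u) (g v) ≤ K * vertexDist A u v)
    (hgh : ∀ t, vertexDist B t (g (h t)) ≤ K) : IsHyperbolicSpace (CayleySpace B hB) := by
  have hK : 0 ≤ K := (CayleyPoint.vertexDist_nonneg _ _).trans (hgh 1)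
  have hlower : ∀ u v, vertexDist B u v ≤ K * vertexDist A (h u) (h v) + 2 * K := by
    intro u v
    have htri := CayleyPoint.vertexDist_triangle hB u (g (h u)) v
    have htri' := CayleyPoint.vertexDist_triangle hB (g (h u)) (g (h v)) v
    rw [CayleyPoint.vertexDist_comm (g (h v)) v] at htri'
    linarith [hg (h u) (h v), hgh u, hgh v]
  refine hyp.of_quasiIsometricOn_univ (CayleySpace.isGeodesicSpace B hB) (K := 2 * K + 2)
    (f := fun p => CayleySpace.ofVertex A hA (h (CayleyPoint.src p)))
    ⟨fun p _ q _ => ?_, fun p _ q _ => ?_⟩ <;>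
  rw [CayleySpace.dist_ofVertex] <;>
  obtain ⟨hpq, hpq'⟩ := abs_le.1 (CayleySpace.abs_dist_sub_vertexDist_src_le p q)
  · calc vertexDist A (h (CayleyPoint.src p)) (h (CayleyPoint.src q))
        ≤ K * vertexDist B (CayleyPoint.src p) (CayleyPoint.src q) := hh _ _
      _ ≤ K * (dist p q + 2) := mul_le_mul_of_nonneg_left (by linarith) hK
      _ ≤ (2 * K + 2) * dist p q + (2 * K + 2) := by
        linarith [mul_nonneg (add_nonneg hK zero_le_two) (dist_nonneg (x := p) (y := q))]
  · have hnn := CayleyPoint.vertexDist_nonneg (A := A) (h (CayleyPoint.src p))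
      (h (CayleyPoint.src q))
    linarith [hlower (CayleyPoint.src p) (CayleyPoint.src q),
      mul_nonneg (add_nonneg hK zero_le_two) hnn]

end CayleyGraphs

section LargeSubsemigroups

variable {S T : Type*} [Monoid S] [Monoid T] {A : Set S} {B : Set T}

theorem IsFiniteGeometricType.finite_setOf_mul_mem (hS : IsFiniteGeometricType S) (a : S)
    {C : Set S} (hC : C.Finite) : {x | x * a ∈ C}.Finite := by
  obtain ⟨A, -, hA, n, hn⟩ := hS
  induction a using Submonoid.induction_of_closure_eq_top_right hA generalizing C with
  | one => simpa using hC
  | mul_right a b hb ih =>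
    have hfiber : {x | x * b ∈ C}.Finite :=
      hC.preimage' fun q _ => Set.finite_of_encard_le_coe (hn q b hb)
    simpa only [mul_assoc, mem_ofPred_eq] using ih hfiber

/-- The suffix `u` is found by reading a word for `t` from the right until it leaves `F` for
good. -/
theorem exists_mul_eq_of_notMem (hB : Submonoid.closure B = ⊤) {F : Set T} {t : T} (ht : t ∉ F) :
    ∃ v, ∃ u ∈ insert 1 (B * F), u ∉ F ∧ v * u = t := by
  induction t using Submonoid.induction_of_closure_eq_top_left hB with
  | one => exact ⟨1, 1, mem_insert _ _, ht, one_mul 1⟩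
  | mul_left b hb t ih =>
    by_cases htF : t ∈ F
    · exact ⟨1, b * t, Or.inr (mul_mem_mul hb htF), ht, one_mul _⟩
    · obtain ⟨v, u, hu, huF, rfl⟩ := ih htF
      exact ⟨b * v, u, hu, huF, mul_assoc b v u⟩

variable {φ : T →ₙ* S}

theorem exists_finite_generators_of_range (hC : (range φ)ᶜ.Finite) (hBf : B.Finite)
    (hB : Submonoid.closure B = ⊤) : ∃ A : Set S, A.Finite ∧ Submonoid.closure A = ⊤ := by
  -- `φ 1` has to be added by hand, as `φ` need not preserve the identity.
  refine ⟨φ '' insert 1 B ∪ (range φ)ᶜ, ((hBf.insert 1).image φ).union hC,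
    eq_top_iff.2 fun s _ => ?_⟩
  by_cases hs : s ∈ range φ
  · obtain ⟨t, rfl⟩ := hs
    have hgen : ∀ b ∈ insert 1 B, φ b ∈ Submonoid.closure (φ '' insert 1 B ∪ (range φ)ᶜ) :=
      fun b hb => Submonoid.subset_closure (Or.inl (mem_image_of_mem φ hb))
    induction t using Submonoid.induction_of_closure_eq_top_left hB with
    | one => exact hgen 1 (mem_insert _ _)
    | mul_left b hb t ih =>
      rw [map_mul]
      exact mul_mem (hgen b (mem_insert_of_mem _ hb)) (ih trivial)
  · exact Submonoid.subset_closure (Or.inr hs)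

theorem exists_finite_generators_of_injective (hφ : Function.Injective φ)
    (hC : (range φ)ᶜ.Finite) (hAf : A.Finite) (hA : Submonoid.closure A = ⊤) :
    ∃ B : Set T, B.Finite ∧ Submonoid.closure B = ⊤ := by
  set C : Set S := insert 1 (range φ)ᶜ
  have hCf : C.Finite := hC.insert 1
  set B : Set T := φ ⁻¹' (C * insert 1 A * C)
  have hB : ∀ {t : T} {c a d : S}, c ∈ C → a ∈ insert 1 A → d ∈ C → φ t = c * a * d →
      t ∈ Submonoid.closure B := fun hc ha hd ht =>
    Submonoid.subset_closure (mem_preimage.2 (ht ▸ mul_mem_mul (mul_mem_mul hc ha) hd))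
  have h₁C : (1 : S) ∈ C := mem_insert _ _
  have hmem : ∀ s : S, ∀ c ∈ C, ∀ t, φ t = c * s → t ∈ Submonoid.closure B := by
    intro s
    induction s using Submonoid.induction_of_closure_eq_top_left hA with
    | one => exact fun c hc t ht => hB hc (mem_insert _ _) h₁C (by rw [ht, mul_one (c * 1)])
    | mul_left a ha s ih =>
      intro c hc t ht
      rw [← mul_assoc] at ht
      by_cases hca : c * a ∈ range φ
      · by_cases hs : s ∈ range φ
        · obtain ⟨t₁, ht₁⟩ := hca
          obtain ⟨t₂, rfl⟩ := hs
          obtain rfl : t = t₁ * t₂ := hφ (by rw [ht, map_mul, ht₁])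
          exact mul_mem (hB hc (Or.inr ha) h₁C (by rw [ht₁, mul_one]))
            (ih 1 h₁C t₂ (one_mul _).symm)
        · exact hB hc (Or.inr ha) (Or.inr hs) ht
      · exact ih (c * a) (Or.inr hca) t ht
  exact ⟨B, ((hCf.mul (hAf.insert 1)).mul hCf).preimage hφ.injOn,
    eq_top_iff.2 fun t _ => hmem (φ t) 1 h₁C t (one_mul _).symm⟩

theorem eventually_vertexDist_hom_le (φ : T →ₙ* S) (hA : Submonoid.closure A = ⊤)
    (hBf : B.Finite) (hB : Submonoid.closure B = ⊤) :
    ∀ᶠ K : ℝ in atTop, ∀ u v, vertexDist A (φ u) (φ v) ≤ K * vertexDist B u v := by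
  refine eventually_vertexDist_map_le hB hBf hA φ fun b _ => ?_
  filter_upwards [eventually_vertexDist_mul_mul_le hA 1 (φ b)] with K hK t
  simpa only [mul_one, map_mul] using hK (φ t)

theorem eventually_vertexDist_leftInverse_mul_le (hC : (range φ)ᶜ.Finite) (hBf : B.Finite)
    (hB : Submonoid.closure B = ⊤) {ψ : S → T} (hψ : Function.LeftInverse ψ φ) {a : S}
    (ha : {t | φ t * a ∉ range φ}.Finite) :
    ∀ᶠ K : ℝ in atTop, ∀ s, vertexDist B (ψ s) (ψ (s * a)) ≤ K := by
  set F : Set T := {t | φ t * a ∉ range φ}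
  have hexceptional : ∀ᶠ K : ℝ in atTop, ∀ s ∈ (range φ)ᶜ ∪ φ '' F,
      vertexDist B (ψ s) (ψ (s * a)) ≤ K :=
    (eventually_all_finite (hC.union (ha.image φ))).2 fun _ _ => eventually_ge_atTop _
  have hsuffixes : ∀ᶠ K : ℝ in atTop, ∀ u ∈ insert 1 (B * F),
      ∀ v, vertexDist B (v * u) (v * ψ (φ u * a)) ≤ K :=
    (eventually_all_finite ((hBf.mul ha).insert 1)).2 fun u _ =>
      eventually_vertexDist_mul_mul_le hB u (ψ (φ u * a))
  filter_upwards [hexceptional, hsuffixes] with K hK hK' s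
  by_cases hs : s ∈ (range φ)ᶜ ∪ φ '' F
  · exact hK s hs
  obtain ⟨⟨t, rfl⟩, htF⟩ : s ∈ range φ ∧ s ∉ φ '' F := by
    simpa only [mem_union, mem_compl_iff, not_or, not_not] using hs
  obtain ⟨v, u, hu, huF, rfl⟩ := exists_mul_eq_of_notMem hB fun htF' => htF ⟨t, htF', rfl⟩
  obtain ⟨w, hw⟩ : φ u * a ∈ range φ := not_not.1 huF
  have hwa : φ (v * u) * a = φ (v * w) := by rw [map_mul, mul_assoc, ← hw, ← map_mul]
  have hvu := hK' u hu v
  rw [← hw, hψ w] at hvu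
  rwa [hψ, hwa, hψ]

theorem eventually_vertexDist_apply_leftInverse_le (hC : (range φ)ᶜ.Finite) {ψ : S → T}
    (hψ : Function.LeftInverse ψ φ) : ∀ᶠ K : ℝ in atTop, ∀ s, vertexDist A s (φ (ψ s)) ≤ K := by
  filter_upwards [eventually_ge_atTop 0, (eventually_all_finite hC).2
    fun s _ => eventually_ge_atTop (vertexDist A s (φ (ψ s)))] with K hK₀ hK s
  by_cases hs : s ∈ range φ
  · obtain ⟨t, rfl⟩ := hs
    rwa [hψ, CayleyPoint.vertexDist_self]
  · exact hK s hs

theorem isHyperbolicSpace_cayleySpace_iff (hφ : Function.Injective φ) (hC : (range φ)ᶜ.Finite)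
    (hright : ∀ a, {t | φ t * a ∉ range φ}.Finite) (hAf : A.Finite)
    (hA : Submonoid.closure A = ⊤) (hBf : B.Finite) (hB : Submonoid.closure B = ⊤) :
    IsHyperbolicSpace (CayleySpace B hB) ↔ IsHyperbolicSpace (CayleySpace A hA) := by
  obtain ⟨ψ, hψ⟩ := hφ.hasLeftInverse
  have hψ_lip := eventually_vertexDist_map_le hA hAf hB ψ fun a _ =>
    eventually_vertexDist_leftInverse_mul_le hC hBf hB hψ (hright a)
  obtain ⟨K, hK₀, hφK, hψK, hφψK⟩ := ((eventually_ge_atTop 0).and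
    ((eventually_vertexDist_hom_le φ hA hBf hB).and
      (hψ_lip.and (eventually_vertexDist_apply_leftInverse_le hC hψ)))).exists
  have hψφK : ∀ t, vertexDist B t (ψ (φ t)) ≤ K := fun t => by
    rwa [hψ, CayleyPoint.vertexDist_self]
  exact ⟨fun h => h.of_vertexDist_le hψK hφK hφψK, fun h => h.of_vertexDist_le hφK hψK hψφK⟩

end LargeSubsemigroups

theorem mainTheorem3_general {S : Type*} {T : Type*} [Monoid S] [Monoid T] (φ : T →ₙ* S)
    (hφ : Function.Injective φ) (hlarge : IsLargeSubsemigroup (MulHom.srange φ))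
    (hright : ∀ a, {t | φ t * a ∉ MulHom.srange φ}.Finite) :
    IsHyperbolicMonoid T ↔ IsHyperbolicMonoid S := by
  constructor
  · rintro ⟨B, hB, hBf, h⟩
    obtain ⟨A, hAf, hA⟩ := exists_finite_generators_of_range hlarge hBf hB
    exact ⟨A, hA, hAf, (isHyperbolicSpace_cayleySpace_iff hφ hlarge hright hAf hA hBf hB).1 h⟩
  · rintro ⟨A, hA, hAf, h⟩
    obtain ⟨B, hBf, hB⟩ := exists_finite_generators_of_injective hφ hlarge hAf hA
    exact ⟨B, hB, hBf, (isHyperbolicSpace_cayleySpace_iff hφ hlarge hright hAf hA hBf hB).2 h⟩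

theorem mainTheorem3 {S : Type*} {T : Type*} [Monoid S] [Monoid T] (φ : T →ₙ* S)
    (hφ : Function.Injective φ) (hlarge : IsLargeSubsemigroup (MulHom.srange φ))
    (hS : IsFiniteGeometricType S) :
    (IsHyperbolicMonoid T → IsHyperbolicMonoid S) ∧
      (IsHyperbolicMonoid S → IsHyperbolicMonoid T) :=
  iff_iff_implies_and_implies.1 <| mainTheorem3_general φ hφ hlarge fun a =>
    (hS.finite_setOf_mul_mem a hlarge).preimage hφ.injOn
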